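/- Let $\mathcal D\subset\mathbb Z_{+}^3$ be a three-dimensional Ferrers diagram, i.e. a nonempty finite set such that $(i_0,j_0,k_0)\in\mathcal D$, $1\le i\le i_0$, $1\le j\le j_0$, $1\le k\le k_0$ imply $(i,j,k)\in\mathcal D$. For a finite set $\mathcal E\subset\mathbb Z_+^3$ let $a_{\mathcal E},b_{\mathcal E},c_{\mathcal E}$ be the numbers of distinct first, second and third coordinates of its points, and let $\mathcal D^i$ be the set of points of $\mathcal D$ with first coordinate $i$. For $u=(i_0,j_0,k_0)\in\mathcal D$ put $\beta_{\mathcal D}(u)=\max\{j:(i_0,j,k_0)\in\mathcal D\}$ and $\gamma_{\mathcal D}(u)=\max\{k:(i_0,j_0,k)\in\mathcal D\}$. Assume that $\mathcal D$ has the strong projection property: for all $1\le i\le a_{\mathcal D}-1$ and all $u\in\mathcal D^i$, $$b_{\mathcal D^{i+1}}\le\beta_{\mathcal D}(u)\quad\text{and}\quad c_{\mathcal D^{i+1}}\le\gamma_{\mathcal D}(u).$$ Let $\mathbb K$ be a field and let $\mathbf I_2(\mathcal D)\subset\mathbb K[T_u:u\in\mathcal D]$ be the ideal generated by all binomials $T_uT_v-T_pT_q$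 with $u,v,p,q\in\mathcal D$ such that $p,q$ arise from $u,v$ by exchanging their first, or their second, or their third coordinates. Let $\operatorname{in}(\mathbf I_2(\mathcal D))$ be its initial ideal for the lexicographic monomial order in which $T_u>T_v$ when $u$ precedes $v$ lexicographically. Then $\operatorname{in}(\mathbf I_2(\mathcal D))$ is a squarefree monomial ideal, its Stanley--Reisner complex $\Delta(\mathcal D)$ on the vertex set $\mathcal D$ is pure vertex-decomposable, and the lexicographic order on $\mathcal D$ is a shedding order on $\Delta(\mathcal D)$. Here a simplicial complex $\Delta$ is pure vertex-decomposable if it is pure and either it is a simplex (possibly $\{\varnothing\}$) or it has a shedding vertex, i.e. a vertex $v$ such that every facet of the deletion $\Delta\setminus v$ is a facet of $\Delta$ and both $\Delta\setminus v$ and $\operatorname{link}_\Delta(v)$ are pure vertex-decomposable. A total order on the vertices is a shedding order if, when the vertices are deleted one after another starting with the first, each complex that occurs is pure vertex-decomposable, and the vertex $u$ to be deleted next is a shedding vertex of it unless that complex is a cone with apex $u$. -/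

import Mathlib

/-! ### Lattice points and three-dimensional Ferrers diagrams -/

namespace Ferrers

/-- Lattice points `(i, j, k)`. The type carries the lexicographic linear order: compare `i` first,
then `j`, then `k`. The points with positive coordinates are singled out in `IsFerrers`. -/
abbrev Point : Type := ℕ ×ₗ ℕ ×ₗ ℕ

/-- The point with coordinates `i`, `j`, `k`. -/
def pt (i j k : ℕ) : Point := toLex (i, toLex (j, k))

/-- First coordinate. -/
def px (u : Point) : ℕ := (ofLex u).1

/-- Second coordinate. -/
def py (u : Point) : ℕ := (ofLex (ofLex u).2).1

/-- Third coordinate. -/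
def pz (u : Point) : ℕ := (ofLex (ofLex u).2).2

/-- A three-dimensional Ferrers diagram: a nonempty finite set of points with positive coordinates
which contains, with `(i₀, j₀, k₀)`, every `(i, j, k)` with `1 ≤ i ≤ i₀`, `1 ≤ j ≤ j₀`,
`1 ≤ k ≤ k₀`. -/
structure IsFerrers (D : Finset Point) : Prop where
  nonempty : D.Nonempty
  pos : ∀ u ∈ D, 1 ≤ px u ∧ 1 ≤ py u ∧ 1 ≤ pz u
  mem_of_le : ∀ u ∈ D, ∀ i j k : ℕ, 1 ≤ i → i ≤ px u → 1 ≤ j → j ≤ py u → 1 ≤ k → k ≤ pz u →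
    pt i j k ∈ D

/-- Essential length `a_D`: the number of first coordinates that occur. -/
def essLength (D : Finset Point) : ℕ := (D.image px).card

/-- Essential width `b_D`: the number of second coordinates that occur. -/
def essWidth (D : Finset Point) : ℕ := (D.image py).card

/-- Essential height `c_D`: the number of third coordinates that occur. -/
def essHeight (D : Finset Point) : ℕ := (D.image pz).card

/-- The `x = i` layer of `D`. -/
def layer (D : Finset Point) (i : ℕ) : Finset Point := D.filter fun u => px u = i

/-- `β_D(u) = max {j : (i₀, j, k₀) ∈ D}` for `u = (i₀, j₀, k₀)`. -/
def beta (D : Finset Point) (u : Point) : ℕ :=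
  (D.filter fun v => px v = px u ∧ pz v = pz u).sup py

/-- `γ_D(u) = max {k : (i₀, j₀, k) ∈ D}` for `u = (i₀, j₀, k₀)`. -/
def gamma (D : Finset Point) (u : Point) : ℕ :=
  (D.filter fun v => px v = px u ∧ py v = py u).sup pz

/-- The strong projection property: for `1 ≤ i ≤ a_D - 1` and every `u` in the `x = i` layer, the
essential width and height of the `x = i + 1` layer are at most `β_D(u)` and `γ_D(u)`. -/
def StrongProjectionProperty (D : Finset Point) : Prop :=
  ∀ i : ℕ, 1 ≤ i → i + 1 ≤ essLength D → ∀ u ∈ layer D i,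
    essWidth (layer D (i + 1)) ≤ beta D u ∧ essHeight (layer D (i + 1)) ≤ gamma D u

/-! ### The ideal of 2-minors and initial ideals -/

open MvPolynomial

/-- The 2-minors of `D` in the polynomial ring with one variable `T_u` for each `u ∈ D`: all
`T_u T_v - T_p T_q` with `u, v, p, q ∈ D`, where `p, q` arise from `u, v` by exchanging the
first coordinates, or the second ones, or the third ones. -/
def minors (K : Type*) [Field K] (D : Finset Point) : Set (MvPolynomial D K) :=
  {f | ∃ u v p q : D,
    (((p : Point) = pt (px v) (py u) (pz u) ∧ (q : Point) = pt (px u) (py v) (pz v)) ∨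
     ((p : Point) = pt (px u) (py v) (pz u) ∧ (q : Point) = pt (px v) (py u) (pz v)) ∨
     ((p : Point) = pt (px u) (py u) (pz v) ∧ (q : Point) = pt (px v) (py v) (pz u))) ∧
    f = X u * X v - X p * X q}

/-- The ideal of 2-minors `I₂(D)`. -/
noncomputable def minorsIdeal (K : Type*) [Field K] (D : Finset Point) : Ideal (MvPolynomial D K) :=
  Ideal.span (minors K D)

/-- The initial ideal of `I` with respect to the monomial order `m`. -/
noncomputable def initialIdeal {σ K : Type*} [Field K] (m : MonomialOrder σ) (I : Ideal (MvPolynomial σ K)) :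
    Ideal (MvPolynomial σ K) :=
  Ideal.span (m.leadingTerm '' (I : Set (MvPolynomial σ K)))

/-- `I` is generated by squarefree monomials. -/
def IsSquarefreeMonomialIdeal {σ K : Type*} [Field K] (I : Ideal (MvPolynomial σ K)) : Prop :=
  ∃ S : Set (Finset σ), I = Ideal.span ((fun F : Finset σ => ∏ v ∈ F, X v) '' S)

/-- The initial ideal of `I₂(D)` for the lexicographic monomial order in which `T_u > T_v` when `u`
precedes `v` lexicographically. -/
noncomputable def initialMinorsIdeal (K : Type*) [Field K] (D : Finset Point) :
    Ideal (MvPolynomial D K) :=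
  initialIdeal MonomialOrder.lex (minorsIdeal K D)

/-! ### Simplicial complexes

As usual for Stanley--Reisner ideals, and unlike in Mathlib's `PreAbstractSimplicialComplex`, the
empty set counts as a face, so that the complex `{∅}` differs from the void complex. -/

/-- Simplicial complexes with vertices in `V`: families of finite sets closed under subsets. Elements
of `V` need not be vertices of the complex. -/
structure Complex (V : Type*) where
  faces : Set (Finset V)
  down_closed : ∀ F ∈ faces, ∀ G : Finset V, G ⊆ F → G ∈ faces

namespace Complex

variable {V : Type*}

/-- `F` is a facet: a face that is maximal under inclusion. -/
def IsFacet (Δ : Complex V) (F : Finset V) : Prop :=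
  F ∈ Δ.faces ∧ ∀ G ∈ Δ.faces, F ⊆ G → G = F

/-- All facets have the same dimension. -/
def IsPure (Δ : Complex V) : Prop :=
  ∀ F G : Finset V, Δ.IsFacet F → Δ.IsFacet G → F.card = G.card

/-- The faces of `Δ` are all the subsets of one finite set (possibly empty). -/
def IsSimplex (Δ : Complex V) : Prop :=
  ∃ s : Finset V, ∀ F : Finset V, F ∈ Δ.faces ↔ F ⊆ s

/-- The restriction of `Δ` to a set `A`: the faces contained in `A`. -/
def restrict (Δ : Complex V) (A : Set V) : Complex V where
  faces := {F | F ∈ Δ.faces ∧ ∀ w ∈ F, w ∈ A}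
  down_closed := fun F hF G hG =>
    ⟨Δ.down_closed F hF.1 G hG, fun w hw => hF.2 w (hG hw)⟩

/-- The deletion `Δ \ v`: the faces that do not contain `v`. -/
def deletion (Δ : Complex V) (v : V) : Complex V := Δ.restrict {w | w ≠ v}

/-- The link of `v`: the sets `F` with `v ∉ F` and `F ∪ {v} ∈ Δ`. -/
def link (Δ : Complex V) (v : V) : Complex V where
  faces := {F | ∃ h : v ∉ F, Finset.cons v F h ∈ Δ.faces}
  down_closed := fun _ ⟨h, hF⟩ _ hG =>
    ⟨fun hv => h (hG hv), Δ.down_closed _ hF _ (Finset.cons_subset_cons.2 hG)⟩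

/-- `Δ` is a nonvoid cone with apex `v`: every face lies in a face that contains `v`. -/
def IsConeWithApex (Δ : Complex V) (v : V) : Prop :=
  Δ.faces.Nonempty ∧ ∀ F ∈ Δ.faces, ∃ G ∈ Δ.faces, v ∈ G ∧ F ⊆ G

/-- Pure vertex-decomposable complexes: `Δ` is pure, and either it is a simplex, or it has a vertex `v`
such that every facet of `Δ \ v` is a facet of `Δ` (so `Δ \ v` has the dimension of `Δ`), and both
`Δ \ v` and the link of `v` are pure vertex-decomposable. -/
inductive IsPureVertexDecomposable : Complex V → Prop
  | simplex (Δ : Complex V) (h : Δ.IsSimplex) : IsPureVertexDecomposable Δ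
  | shed (Δ : Complex V) (v : V) (hpure : Δ.IsPure) (hv : {v} ∈ Δ.faces)
      (hfacet : ∀ F : Finset V, (Δ.deletion v).IsFacet F → Δ.IsFacet F)
      (hdel : IsPureVertexDecomposable (Δ.deletion v))
      (hlink : IsPureVertexDecomposable (Δ.link v)) : IsPureVertexDecomposable Δ

/-- `v` is a shedding vertex of the pure complex `Δ`: it can serve as the vertex `v` in the definition
of pure vertex-decomposability. -/
structure IsSheddingVertex (Δ : Complex V) (v : V) : Prop where
  pure : Δ.IsPure
  vertex : {v} ∈ Δ.faces
  facet : ∀ F : Finset V, (Δ.deletion v).IsFacet F → Δ.IsFacet F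
  deletion_vd : (Δ.deletion v).IsPureVertexDecomposable
  link_vd : (Δ.link v).IsPureVertexDecomposable

end Complex

/-- The linear order of `V` is a shedding order on `Δ`: if the elements of `V` are removed one after
another, starting with the smallest, then each complex that occurs is pure vertex-decomposable, and
the element `u` to be removed next is a shedding vertex of it, unless the complex is a cone with
apex `u` (in which case removing `u` only strips off the apex). -/
def Complex.IsSheddingOrder {V : Type*} [LinearOrder V] (Δ : Complex V) : Prop :=
  ∀ u : V, (Δ.restrict {w | u ≤ w}).IsPureVertexDecomposable ∧
    ((Δ.restrict {w | u ≤ w}).IsConeWithApex u ∨ (Δ.restrict {w | u ≤ w}).IsSheddingVertex u)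

/-- The Stanley--Reisner complex of a squarefree monomial ideal `I`: the faces are the `F` with
`∏_{v ∈ F} X_v ∉ I`. -/
def stanleyReisner {σ K : Type*} [Field K] (I : Ideal (MvPolynomial σ K)) : Complex σ where
  faces := {F | (∏ v ∈ F, (X v : MvPolynomial σ K)) ∉ I}
  down_closed := fun F hF G hG h => hF (by
    obtain ⟨c, hc⟩ := Finset.prod_dvd_prod_of_subset G F (fun v => (X v : MvPolynomial σ K)) hG
    show (∏ v ∈ F, (X v : MvPolynomial σ K)) ∈ I
    rw [hc]
    exact I.mul_mem_right c h)

/-- The complex `Δ(D)` on the vertex set `D`. -/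
noncomputable def diagramComplex (K : Type*) [Field K] (D : Finset Point) : Complex D :=
  stanleyReisner (initialMinorsIdeal K D)

end Ferrers

/-! ### Lexicographic order and compatibility of points -/

namespace Ferrers

open MvPolynomial

/-! The substitution `T_u ↦ x_i y_j z_k` kills all 2-minors, and a monomial whose support is
pairwise compatible is the lex-smallest one with its image (`IsStandard.not_lt`). So no nonzero
element of the ideal has a standard leading monomial. Conversely, the strong projection property
supplies the points that make every incompatible pair the leading monomial of a 2-minor. Hence the
initial ideal is generated by the incompatible pairs, and `Δ(D)` is the flag complex of `Compat`
(`mem_faces_diagramComplex`).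

Vertex-decomposability is an induction over truncations of `D`. Deleting the first vertex `u` leaves
a truncation, and the link of `u` is a truncation together with cone points, the points above `u` in
its column. What remains is that `u` is a shedding vertex unless it is an apex. This follows from an
exchange property: every facet `F` of the link becomes a facet of the deletion when some `w`
incompatible with `u` is added. It gives both the facet condition and purity
(`HasExchange.isSheddingVertex`).

For `u = (x, y, z)`, take `w = (x, y+1, z+1)` if this point is available. Otherwise the part of
layer `x` still present is flat in one direction, and `w` lies in layer `x+1`: one coordinate is one
more than that of `u`, the other is the largest one that `F` attains in the layers from `x+2` on. -/

@[simp] theorem px_pt (i j k : ℕ) : px (pt i j k) = i := rfl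

@[simp] theorem py_pt (i j k : ℕ) : py (pt i j k) = j := rfl

@[simp] theorem pz_pt (i j k : ℕ) : pz (pt i j k) = k := rfl

theorem point_ext {u v : Point} (hx : px u = px v) (hy : py u = py v) (hz : pz u = pz v) :
    u = v := by
  have h : ∀ w : Point, w = pt (px w) (py w) (pz w) := fun _ => rfl
  rw [h u, h v, hx, hy, hz]

theorem point_lt_iff {u v : Point} :
    u < v ↔ px u < px v ∨ px u = px v ∧ (py u < py v ∨ py u = py v ∧ pz u < pz v) := by
  rw [Prod.Lex.lt_iff, Prod.Lex.lt_iff]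
  rfl

theorem point_le_iff {u v : Point} :
    u ≤ v ↔ px u < px v ∨ px u = px v ∧ (py u < py v ∨ py u = py v ∧ pz u ≤ pz v) := by
  rw [Prod.Lex.le_iff, Prod.Lex.le_iff]
  rfl

/-- Two points are compatible if `T_u T_v` is a standard monomial: in one layer, the second and the
third coordinates are sorted in opposite directions; otherwise the point in the later layer has the
smaller second and third coordinates. -/
def Compat (u v : Point) : Prop :=
  (px u < px v ∧ py v ≤ py u ∧ pz v ≤ pz u) ∨ (px v < px u ∧ py u ≤ py v ∧ pz u ≤ pz v) ∨
  (px u = px v ∧ (py u ≤ py v ∧ pz v ≤ pz u ∨ py v ≤ py u ∧ pz u ≤ pz v))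

theorem Compat.refl (u : Point) : Compat u u := by
  unfold Compat; omega

theorem Compat.symm {u v : Point} (h : Compat u v) : Compat v u := by
  unfold Compat at *; omega

/-! ### Consequences of the strong projection property -/

section Diagram

variable {D : Finset Point}

theorem IsFerrers.pt_mem (hD : IsFerrers D) {u : Point} (hu : u ∈ D) {i j k : ℕ} (hi : 1 ≤ i)
    (hiu : i ≤ px u) (hj : 1 ≤ j) (hju : j ≤ py u) (hk : 1 ≤ k) (hku : k ≤ pz u) : pt i j k ∈ D :=
  hD.mem_of_le u hu i j k hi hiu hj hju hk hku

theorem le_card_of_forall_mem {s : Finset ℕ} {n : ℕ} (h : ∀ j, 1 ≤ j → j ≤ n → j ∈ s) :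
    n ≤ s.card := by
  calc n = (Finset.Icc 1 n).card := by simp
    _ ≤ s.card := Finset.card_le_card fun j hj => by
      rw [Finset.mem_Icc] at hj
      exact h j hj.1 hj.2

theorem IsFerrers.px_le_essLength (hD : IsFerrers D) {v : Point} (hv : v ∈ D) :
    px v ≤ essLength D := by
  obtain ⟨_, hy, hz⟩ := hD.pos v hv
  exact le_card_of_forall_mem fun i h1 h2 =>
    Finset.mem_image.2 ⟨pt i (py v) (pz v), hD.pt_mem hv h1 h2 hy le_rfl hz le_rfl, rfl⟩

theorem IsFerrers.py_le_essWidth (hD : IsFerrers D) {v : Point} (hv : v ∈ D) {i : ℕ} (hi : 1 ≤ i)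
    (hiv : i ≤ px v) : py v ≤ essWidth (layer D i) := by
  obtain ⟨_, hy, hz⟩ := hD.pos v hv
  exact le_card_of_forall_mem fun j h1 h2 =>
    Finset.mem_image.2 ⟨pt i j (pz v), Finset.mem_filter.2
      ⟨hD.pt_mem hv hi hiv h1 h2 hz le_rfl, rfl⟩, rfl⟩

theorem IsFerrers.pz_le_essHeight (hD : IsFerrers D) {v : Point} (hv : v ∈ D) {i : ℕ} (hi : 1 ≤ i)
    (hiv : i ≤ px v) : pz v ≤ essHeight (layer D i) := by
  obtain ⟨_, hy, hz⟩ := hD.pos v hv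
  exact le_card_of_forall_mem fun k h1 h2 =>
    Finset.mem_image.2 ⟨pt i (py v) k, Finset.mem_filter.2
      ⟨hD.pt_mem hv hi hiv hy le_rfl h1 h2, rfl⟩, rfl⟩

/-- A row of a layer reaches at least as far as every later layer. -/
theorem StrongProjectionProperty.pt_mem_y (hS : StrongProjectionProperty D) (hD : IsFerrers D)
    {u v : Point} (hu : u ∈ D) (hv : v ∈ D) (huv : px u < px v) :
    pt (px u) (py v) (pz u) ∈ D := by
  obtain ⟨hx, hy, hz⟩ := hD.pos u hu
  obtain ⟨_, hvy, _⟩ := hD.pos v hv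
  have h := (hS (px u) hx (le_trans huv (hD.px_le_essLength hv)) u
    (Finset.mem_filter.2 ⟨hu, rfl⟩)).1
  have h' : py v ≤ beta D u := (hD.py_le_essWidth hv (by omega) huv).trans h
  -- The supremum defaults to `0` on the empty set; `1 ≤ py v` ensures that the bound is reached at
  -- an actual point.
  obtain ⟨w, hw, hvw⟩ := (Finset.le_sup_iff (by rwa [bot_eq_zero, ← Nat.succ_le_iff])).1 h'
  obtain ⟨hwD, hwx, hwz⟩ := Finset.mem_filter.1 hw
  exact hD.pt_mem hwD hx hwx.ge hvy hvw hz hwz.ge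

/-- A column of a layer reaches at least as far as every later layer. -/
theorem StrongProjectionProperty.pt_mem_z (hS : StrongProjectionProperty D) (hD : IsFerrers D)
    {u v : Point} (hu : u ∈ D) (hv : v ∈ D) (huv : px u < px v) :
    pt (px u) (py u) (pz v) ∈ D := by
  obtain ⟨hx, hy, hz⟩ := hD.pos u hu
  obtain ⟨_, _, hvz⟩ := hD.pos v hv
  have h := (hS (px u) hx (le_trans huv (hD.px_le_essLength hv)) u
    (Finset.mem_filter.2 ⟨hu, rfl⟩)).2
  have h' : pz v ≤ gamma D u := (hD.pz_le_essHeight hv (by omega) huv).trans h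
  obtain ⟨w, hw, hvw⟩ := (Finset.le_sup_iff (by rwa [bot_eq_zero, ← Nat.succ_le_iff])).1 h'
  obtain ⟨hwD, hwx, hwy⟩ := Finset.mem_filter.1 hw
  exact hD.pt_mem hwD hx hwx.ge hy hwy.ge hvz hvw

end Diagram

/-! ### The initial ideal -/

/-- The exponent vector of the monomial `x_i y_j z_k` that belongs to the point `(i, j, k)`. -/
noncomputable def multidegree (u : Point) : (ℕ ⊕ ℕ ⊕ ℕ) →₀ ℕ :=
  Finsupp.single (Sum.inl (px u)) 1 + Finsupp.single (Sum.inr (Sum.inl (py u))) 1 +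
    Finsupp.single (Sum.inr (Sum.inr (pz u))) 1

section Toric

variable (K : Type*) [Field K] {D : Finset Point}

/-- The parametrization `T_u ↦ x_i y_j z_k`. -/
noncomputable def toricMap (D : Finset Point) :
    MvPolynomial D K →ₐ[K] MvPolynomial (ℕ ⊕ ℕ ⊕ ℕ) K :=
  aeval fun u : D => monomial (multidegree u) 1

variable {K}

theorem toricMap_monomial (a : D →₀ ℕ) (c : K) :
    toricMap K D (monomial a c) =
      monomial (Finsupp.weight (fun u : D => multidegree u) a) c := by
  rw [toricMap, aeval_monomial, Finsupp.weight_apply, Finsupp.prod, Finsupp.sum]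
  simp only [monomial_pow, one_pow]
  rw [← monomial_sum_one, algebraMap_eq, C_mul_monomial, mul_one]

theorem toricMap_eq_zero {f : MvPolynomial D K} (hf : f ∈ minorsIdeal K D) :
    toricMap K D f = 0 := by
  have h : minorsIdeal K D ≤ RingHom.ker (toricMap K D) := by
    refine Ideal.span_le.2 ?_
    rintro _ ⟨u, v, p, q, h, rfl⟩
    have key : multidegree u + multidegree v = multidegree p + multidegree q := by
      unfold multidegree
      rcases h with ⟨h1, h2⟩ | ⟨h1, h2⟩ | ⟨h1, h2⟩ <;> rw [h1, h2] <;>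
        simp only [px_pt, py_pt, pz_pt] <;> abel
    simp only [SetLike.mem_coe, RingHom.mem_ker, map_sub, map_mul, toricMap, aeval_X,
      monomial_mul, key, sub_self]
  exact h hf

/-- A monomial is standard if the points of its support are pairwise compatible. -/
def IsStandard (a : D →₀ ℕ) : Prop :=
  ∀ u ∈ a.support, ∀ v ∈ a.support, Compat u v

/-- A standard monomial is the smallest monomial of its multidegree. -/
theorem IsStandard.not_lt {a b : D →₀ ℕ} (ha : IsStandard a)
    (hab : Finsupp.weight (fun u : D => multidegree u) b =
      Finsupp.weight (fun u : D => multidegree u) a) : ¬ toLex b < toLex a := by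
  rintro ⟨p, hp, hlt⟩
  simp only [ofLex_toLex] at hp hlt
  -- A linear functional on multidegrees that separates `a` from `b`, where `p` is the first point
  -- at which they differ: it rewards the layer of `p` and penalizes second and third coordinates
  -- beyond those of `p`.
  let h : (ℕ ⊕ ℕ ⊕ ℕ) → ℤ := Sum.elim (fun i => if i = px p then 1 else 0)
    (Sum.elim (fun j => if py p < j then -1 else 0) (fun k => if pz p < k then -1 else 0))
  let g : D → ℤ := fun v => Finsupp.weight h (multidegree v)
  have hg : ∀ v, g v = (if px v = px p then 1 else 0) + (if py p < py v then -1 else 0) +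
      (if pz p < pz v then -1 else 0) := fun v => by
    simp only [g, multidegree, map_add, Finsupp.weight_single, one_smul, h, Sum.elim_inl,
      Sum.elim_inr]
  have hw : ∀ c : D →₀ ℕ, Finsupp.weight h (Finsupp.weight (fun u : D => multidegree u) c) =
      ∑ v, (c v : ℤ) * g v := fun c => by
    rw [Finsupp.weight_eq_sum (w := fun u : D => multidegree u), map_sum]
    exact Finset.sum_congr rfl fun v _ => by rw [map_nsmul, nsmul_eq_mul]
  have hsum : ∑ v, (b v : ℤ) * g v = ∑ v, (a v : ℤ) * g v := by rw [← hw, ← hw, hab]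
  have hpa : p ∈ a.support := Finsupp.mem_support_iff.2 (by omega)
  have hlt' : ∑ v, (b v : ℤ) * g v < ∑ v, (a v : ℤ) * g v := by
    refine Finset.sum_lt_sum (fun v _ => ?_) ⟨p, Finset.mem_univ p, ?_⟩
    · rcases lt_trichotomy v p with hv | rfl | hv
      · rw [hp v hv]
      · have h1 : g v = 1 := by rw [hg]; simp
        rw [h1]; omega
      · have hv' : (p : Point) < v := hv
        rw [point_lt_iff] at hv'
        -- A later point in the layer of `p` exceeds `p` in a second or third coordinate, which
        -- cancels the reward.
        have h1 : g v ≤ 0 := by rw [hg]; split_ifs <;> omega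
        have h2 : (b v : ℤ) * g v ≤ 0 := mul_nonpos_of_nonneg_of_nonpos (by positivity) h1
        by_cases hva : a v = 0
        · simpa [hva] using h2
        -- Compatibility with `p` leaves at most one penalty in the layer of `p` and none in later
        -- layers.
        · have hc := ha p hpa v (Finsupp.mem_support_iff.2 hva)
          unfold Compat at hc
          have h3 : 0 ≤ g v := by rw [hg]; split_ifs <;> omega
          exact h2.trans (mul_nonneg (by positivity) h3)
    · have h1 : g p = 1 := by rw [hg]; simp
      rw [h1]; omega
  exact hlt'.ne hsum

/-- If the leading monomial were standard, every other monomial of `f` with its multidegree would be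
lex-smaller, which is impossible. Its coefficient would then survive in the toric image of `f`,
which is zero. -/
theorem not_isStandard_degree {f : MvPolynomial D K} (hf : f ∈ minorsIdeal K D) (h0 : f ≠ 0) :
    ¬ IsStandard (MonomialOrder.lex.degree f) := by
  intro hs
  set a := MonomialOrder.lex.degree f with ha
  have h1 := congrArg (coeff (Finsupp.weight (fun u : D => multidegree u) a))
    (toricMap_eq_zero hf)
  rw [f.as_sum, map_sum, coeff_sum, coeff_zero] at h1
  rw [Finset.sum_eq_single a] at h1
  · rw [toricMap_monomial, coeff_monomial, if_pos rfl] at h1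
    exact MonomialOrder.coeff_degree_ne_zero_iff.2 h0 h1
  · intro b hb hba
    rw [toricMap_monomial, coeff_monomial, if_neg]
    intro hw
    refine hs.not_lt hw (lt_of_le_of_ne (MonomialOrder.lex.le_degree hb) ?_)
    exact fun h => hba (toLex.injective h)
  · intro h
    exact absurd (MonomialOrder.lex.degree_mem_support h0) h

end Toric

/-! ### Leading terms of 2-minors and the Gröbner basis -/

theorem leadingTerm_monomial_sub {σ K : Type*} [Field K] (m : MonomialOrder σ) {a b : σ →₀ ℕ}
    (h : m.toSyn b < m.toSyn a) :
    m.leadingTerm (monomial a (1 : K) - monomial b 1) = monomial a 1 := by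
  classical
  have h' : m.toSyn (m.degree (monomial b (1 : K))) < m.toSyn (m.degree (monomial a (1 : K))) := by
    simpa [MonomialOrder.degree_monomial] using h
  rw [MonomialOrder.leadingTerm, MonomialOrder.degree_sub_of_lt h',
    MonomialOrder.leadingCoeff_sub_of_lt h', MonomialOrder.leadingCoeff_monomial,
    MonomialOrder.degree_monomial, if_neg one_ne_zero]

/-- The pairs of incompatible points. -/
def incompatiblePairs (D : Finset Point) : Set (Finset D) :=
  {F | ∃ u v : D, ¬ Compat u v ∧ F = {u, v}}

theorem prod_X_eq_monomial {σ K : Type*} [Field K] (F : Finset σ) :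
    (∏ v ∈ F, X v : MvPolynomial σ K) = monomial (∑ v ∈ F, Finsupp.single v 1) 1 := by
  rw [monomial_sum_one]; rfl

theorem lex_single_add_lt {D : Finset Point} {u v p q : D} (hv : u < v) (hp : u < p)
    (hq : u < q) :
    MonomialOrder.lex.toSyn (Finsupp.single p 1 + Finsupp.single q 1) <
      MonomialOrder.lex.toSyn (Finsupp.single u 1 + Finsupp.single v 1) := by
  rw [MonomialOrder.lex_lt_iff]
  refine ⟨u, fun w hw => ?_, ?_⟩
  · simp [hw.ne', (hw.trans hv).ne', (hw.trans hp).ne', (hw.trans hq).ne']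
  · simp [hv.ne', hp.ne', hq.ne']

section InitialIdeal

variable {K : Type*} [Field K] {D : Finset Point}

/-- An incompatible pair is the leading monomial of a 2-minor. -/
theorem monomial_mem_initialMinorsIdeal (hD : IsFerrers D) (hS : StrongProjectionProperty D)
    {u v : D} (huv : u < v) (hc : ¬ Compat u v) :
    (monomial (Finsupp.single u 1 + Finsupp.single v 1) 1 : MvPolynomial D K) ∈
      initialMinorsIdeal K D := by
  have key : ∀ p q : D, u < p → u < q →
      X u * X v - X p * X q ∈ minors K D →
      (monomial (Finsupp.single u 1 + Finsupp.single v 1) 1 : MvPolynomial D K) ∈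
        initialMinorsIdeal K D := by
    intro p q hp hq hm
    refine Ideal.subset_span ⟨_, Ideal.subset_span hm, ?_⟩
    rw [X, X, X, X, monomial_mul, monomial_mul, one_mul]
    exact leadingTerm_monomial_sub _ (lex_single_add_lt huv hp hq)
  obtain ⟨hux, huy, huz⟩ := hD.pos u u.2
  obtain ⟨hvx, hvy, hvz⟩ := hD.pos v v.2
  have hlt : (u : Point) < v := huv
  rw [point_lt_iff] at hlt
  unfold Compat at hc
  -- Exchange second coordinates if `v` is larger there. Otherwise incompatibility forces `v` into a
  -- later layer with a larger third coordinate, and the third coordinates are exchanged. Either way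
  -- both new points come after `u`.
  by_cases hy : py u < py v
  · have hp : pt (px u) (py v) (pz u) ∈ D := by
      rcases hlt with h | h
      · exact hS.pt_mem_y hD u.2 v.2 h
      · exact hD.pt_mem v.2 hux h.1.le hvy le_rfl huz (by omega)
    have hq : pt (px v) (py u) (pz v) ∈ D :=
      hD.pt_mem v.2 hvx le_rfl huy hy.le hvz le_rfl
    refine key ⟨_, hp⟩ ⟨_, hq⟩ ?_ ?_ ⟨u, v, ⟨_, hp⟩, ⟨_, hq⟩, Or.inr (Or.inl ⟨rfl, rfl⟩), rfl⟩
    · change (u : Point) < pt _ _ _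
      rw [point_lt_iff, px_pt, py_pt, pz_pt]; omega
    · change (u : Point) < pt _ _ _
      rw [point_lt_iff, px_pt, py_pt, pz_pt]; omega
  · have hx : px u < px v := by omega
    have hp : pt (px u) (py u) (pz v) ∈ D := hS.pt_mem_z hD u.2 v.2 hx
    have hq : pt (px v) (py v) (pz u) ∈ D :=
      hD.pt_mem v.2 hvx le_rfl hvy le_rfl huz (by omega)
    refine key ⟨_, hp⟩ ⟨_, hq⟩ ?_ ?_ ⟨u, v, ⟨_, hp⟩, ⟨_, hq⟩, Or.inr (Or.inr ⟨rfl, rfl⟩), rfl⟩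
    · change (u : Point) < pt _ _ _
      rw [point_lt_iff, px_pt, py_pt, pz_pt]; omega
    · change (u : Point) < pt _ _ _
      rw [point_lt_iff, px_pt, py_pt, pz_pt]; omega

theorem ne_of_not_compat {u v : D} (h : ¬ Compat u v) : u ≠ v := by
  rintro rfl
  exact h (Compat.refl _)

theorem sum_single_le_iff {σ : Type*} {F : Finset σ} {a : σ →₀ ℕ} :
    ∑ v ∈ F, Finsupp.single v 1 ≤ a ↔ F ⊆ a.support := by
  classical
  have h : ∀ w, (∑ v ∈ F, Finsupp.single v 1 : σ →₀ ℕ) w = if w ∈ F then 1 else 0 := fun w => by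
    simp [Finsupp.finsetSum_apply, Finsupp.single_apply]
  constructor
  · intro hle w hw
    have := hle w
    rw [h, if_pos hw] at this
    exact Finsupp.mem_support_iff.2 (by omega)
  · intro hF w
    rw [h]
    split_ifs with hw
    · exact Nat.one_le_iff_ne_zero.2 (Finsupp.mem_support_iff.1 (hF hw))
    · exact Nat.zero_le _

theorem mem_span_incompatiblePairs {f : MvPolynomial D K} :
    f ∈ Ideal.span ((fun F : Finset D => ∏ v ∈ F, (X v : MvPolynomial D K)) ''
      incompatiblePairs D) ↔ ∀ a ∈ f.support, ¬ IsStandard a := by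
  have h : (fun F : Finset D => ∏ v ∈ F, (X v : MvPolynomial D K)) '' incompatiblePairs D =
      (fun s => monomial s (1 : K)) ''
        ((fun F : Finset D => ∑ v ∈ F, Finsupp.single v 1) '' incompatiblePairs D) := by
    rw [Set.image_image]
    exact Set.image_congr fun F _ => prod_X_eq_monomial F
  rw [h, mem_ideal_span_monomial_image]
  refine forall₂_congr fun a _ => ⟨?_, fun ha => ?_⟩
  · rintro ⟨_, ⟨F, ⟨u, v, hc, rfl⟩, rfl⟩, hle⟩ hs
    have := sum_single_le_iff.1 hle
    exact hc (hs u (this (by simp)) v (this (by simp)))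
  · unfold IsStandard at ha
    push Not at ha
    obtain ⟨u, hu, v, hv, hc⟩ := ha
    refine ⟨_, ⟨{u, v}, ⟨u, v, hc, rfl⟩, rfl⟩, sum_single_le_iff.2 ?_⟩
    intro w hw
    rcases Finset.mem_insert.1 hw with rfl | hw
    · exact hu
    · rwa [Finset.mem_singleton.1 hw]

/-- The 2-minors are a Gröbner basis. -/
theorem initialMinorsIdeal_eq (hD : IsFerrers D) (hS : StrongProjectionProperty D) :
    initialMinorsIdeal K D = Ideal.span ((fun F : Finset D => ∏ v ∈ F, (X v : MvPolynomial D K)) ''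
      incompatiblePairs D) := by
  apply le_antisymm
  · refine Ideal.span_le.2 ?_
    rintro _ ⟨f, hf, rfl⟩
    refine mem_span_incompatiblePairs.2 fun a ha => ?_
    have h0 : f ≠ 0 := by rintro rfl; simp at ha
    rw [MonomialOrder.support_leadingTerm' h0, Finset.mem_singleton] at ha
    rw [ha]
    exact not_isStandard_degree hf h0
  · refine Ideal.span_le.2 ?_
    rintro _ ⟨_, ⟨u, v, hc, rfl⟩, rfl⟩
    have hne := ne_of_not_compat hc
    simp only [SetLike.mem_coe]
    rw [prod_X_eq_monomial, Finset.sum_pair hne]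
    rcases lt_or_gt_of_ne hne with h | h
    · exact monomial_mem_initialMinorsIdeal hD hS h hc
    · rw [add_comm]
      exact monomial_mem_initialMinorsIdeal hD hS h fun h' => hc h'.symm

theorem mem_faces_diagramComplex (hD : IsFerrers D) (hS : StrongProjectionProperty D)
    {F : Finset D} :
    F ∈ (diagramComplex K D).faces ↔ ∀ u ∈ F, ∀ v ∈ F, Compat u v := by
  classical
  have h : (∑ v ∈ F, Finsupp.single v 1 : D →₀ ℕ).support = F := by
    ext w
    simp [Finsupp.finsetSum_apply, Finsupp.single_apply]
  change (∏ v ∈ F, (X v : MvPolynomial D K)) ∉ initialMinorsIdeal K D ↔ _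
  rw [initialMinorsIdeal_eq hD hS, mem_span_incompatiblePairs, prod_X_eq_monomial,
    support_monomial, if_neg one_ne_zero]
  simp only [Finset.mem_singleton, forall_eq, not_not, IsStandard, h]

end InitialIdeal

/-! ### Flag complexes -/

namespace Complex

variable {V : Type*}

theorem ext_faces {Δ Γ : Complex V} (h : ∀ F, F ∈ Δ.faces ↔ F ∈ Γ.faces) : Δ = Γ := by
  cases Δ
  cases Γ
  congr
  exact Set.ext h

/-- The complex of the finite subsets of `E` whose elements are pairwise related by `R`. -/
def flag (R : V → V → Prop) (E : Set V) : Complex V where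
  faces := {F | (∀ u ∈ F, u ∈ E) ∧ ∀ u ∈ F, ∀ v ∈ F, R u v}
  down_closed := fun _ hF _ hG =>
    ⟨fun u hu => hF.1 u (hG hu), fun u hu v hv => hF.2 u (hG hu) v (hG hv)⟩

/-- The vertices of the link of `u` in the flag complex on `E`. -/
def neighbors (R : V → V → Prop) (E : Set V) (u : V) : Set V := {w | w ∈ E ∧ w ≠ u ∧ R u w}

variable {R : V → V → Prop} {E A : Set V} {u : V}

theorem mem_flag {F : Finset V} :
    F ∈ (flag R E).faces ↔ (∀ u ∈ F, u ∈ E) ∧ ∀ u ∈ F, ∀ v ∈ F, R u v := Iff.rfl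

theorem restrict_flag (R : V → V → Prop) (E A : Set V) :
    (flag R E).restrict A = flag R (E ∩ A) := by
  refine ext_faces fun F => ⟨fun h => ?_, fun h => ?_⟩
  · exact ⟨fun u hu => ⟨h.1.1 u hu, h.2 u hu⟩, h.1.2⟩
  · exact ⟨⟨fun u hu => (h.1 u hu).1, h.2⟩, fun u hu => (h.1 u hu).2⟩

theorem deletion_flag (R : V → V → Prop) (E : Set V) (u : V) :
    (flag R E).deletion u = flag R (E \ {u}) :=
  restrict_flag R E _

theorem link_flag (hr : ∀ u, R u u) (hs : ∀ u v, R u v → R v u) (hu : u ∈ E) :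
    (flag R E).link u = flag R (neighbors R E u) := by
  refine ext_faces fun F => ⟨?_, fun h => ?_⟩
  · rintro ⟨huF, h1, h2⟩
    refine ⟨fun v hv => ⟨h1 v (by simp [hv]), ?_, h2 u (by simp) v (by simp [hv])⟩,
      fun v hv w hw => h2 v (by simp [hv]) w (by simp [hw])⟩
    rintro rfl
    exact huF hv
  · refine ⟨fun hF => (h.1 u hF).2.1 rfl, fun v hv => ?_, fun v hv w hw => ?_⟩
    · rcases Finset.mem_cons.1 hv with rfl | hv
      · exact hu
      · exact (h.1 v hv).1
    · rcases Finset.mem_cons.1 hv with rfl | hv' <;> rcases Finset.mem_cons.1 hw with rfl | hw'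
      · exact hr _
      · exact (h.1 w hw').2.2
      · exact hs _ _ (h.1 v hv').2.2
      · exact h.2 v hv' w hw'

/-- In a flag complex a face that is not maximal can be enlarged by a single vertex. -/
theorem isFacet_flag_iff (hr : ∀ u, R u u) (hs : ∀ u v, R u v → R v u) {F : Finset V} :
    (flag R E).IsFacet F ↔
      F ∈ (flag R E).faces ∧ ∀ t ∈ E, (∀ a ∈ F, R t a) → t ∈ F := by
  classical
  refine and_congr_right fun hF => ⟨fun h t ht hta => ?_, fun h G hG hFG => ?_⟩
  · have : insert t F ∈ (flag R E).faces := by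
      refine ⟨fun v hv => ?_, fun v hv w hw => ?_⟩
      · rcases Finset.mem_insert.1 hv with rfl | hv
        · exact ht
        · exact hF.1 v hv
      · rcases Finset.mem_insert.1 hv with rfl | hv' <;> rcases Finset.mem_insert.1 hw with rfl | hw'
        · exact hr _
        · exact hta w hw'
        · exact hs _ _ (hta v hv')
        · exact hF.2 v hv' w hw'
    rw [← h _ this (Finset.subset_insert t F)]
    exact Finset.mem_insert_self t F
  · exact (hFG.antisymm fun t ht => h t (hG.1 t ht) fun a ha => hG.2 t ht a (hFG ha)).symm

theorem exists_isFacet_ge [Finite V] {Δ : Complex V} {F : Finset V} (hF : F ∈ Δ.faces) :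
    ∃ G, Δ.IsFacet G ∧ F ⊆ G := by
  have := Fintype.ofFinite V
  obtain ⟨G, hFG, hG⟩ := (Set.toFinite Δ.faces).exists_le_maximal hF
  exact ⟨G, ⟨hG.1, fun H hH hGH => (hGH.antisymm (hG.2 hH hGH)).symm⟩, hFG⟩

theorem IsPureVertexDecomposable.isPure {Δ : Complex V} (h : Δ.IsPureVertexDecomposable) :
    Δ.IsPure := by
  cases h with
  | simplex _ h =>
    obtain ⟨s, hs⟩ := h
    have key : ∀ F, Δ.IsFacet F → F = s := fun F hF =>
      (hF.2 s ((hs s).2 subset_rfl) ((hs F).1 hF.1)).symm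
    intro F G hF hG
    rw [key F hF, key G hG]
  | shed _ _ h => exact h

theorem IsSheddingVertex.isPureVertexDecomposable {Δ : Complex V} {v : V}
    (h : Δ.IsSheddingVertex v) : Δ.IsPureVertexDecomposable :=
  .shed Δ v h.pure h.vertex h.facet h.deletion_vd h.link_vd

/-! ### Exchange property and shedding vertices -/

/-- Every facet of the link of `u` becomes a facet of the deletion of `u` when a suitable vertex
is added. -/
def HasExchange [DecidableEq V] (R : V → V → Prop) (E : Set V) (u : V) : Prop :=
  ∀ F, (flag R (neighbors R E u)).IsFacet F →
    ∃ w ∈ E, ¬ R u w ∧ (flag R (E \ {u})).IsFacet (insert w F)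

/-- `F` is already maximal among the vertices related to `u`, so maximality of `insert w F` has to
be tested only on vertices not related to `u`. -/
theorem hasExchange_of_forall [DecidableEq V] (hr : ∀ u, R u u)
    (hs : ∀ u v, R u v → R v u)
    (h : ∀ F, (flag R (neighbors R E u)).IsFacet F → ∃ w ∈ E, ¬ R u w ∧ (∀ a ∈ F, R w a) ∧
      ∀ t ∈ E, ¬ R u t → (∀ a ∈ F, R t a) → R t w → t = w) : HasExchange R E u := by
  intro F hF
  obtain ⟨w, hw, huw, hwF, ht⟩ := h F hF
  rw [isFacet_flag_iff hr hs] at hF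
  obtain ⟨⟨h1, h2⟩, h3⟩ := hF
  refine ⟨w, hw, huw, (isFacet_flag_iff hr hs).2 ⟨⟨fun v hv => ?_, fun v hv x hx => ?_⟩,
    fun t htE hta => ?_⟩⟩
  · rcases Finset.mem_insert.1 hv with rfl | hv
    · exact ⟨hw, fun h => huw (by rw [Set.mem_singleton_iff.1 h]; exact hr u)⟩
    · exact ⟨(h1 v hv).1, (h1 v hv).2.1⟩
  · rcases Finset.mem_insert.1 hv with rfl | hv' <;> rcases Finset.mem_insert.1 hx with rfl | hx'
    · exact hr _
    · exact hwF x hx'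
    · exact hs _ _ (hwF v hv')
    · exact h2 v hv' x hx'
  · have htF : ∀ a ∈ F, R t a := fun a ha => hta a (Finset.mem_insert_of_mem ha)
    by_cases hut : R u t
    · exact Finset.mem_insert_of_mem (h3 t ⟨htE.1, htE.2, hut⟩ htF)
    · rw [ht t htE.1 hut htF (hta w (Finset.mem_insert_self w F))]
      exact Finset.mem_insert_self w F

theorem neighbors_union (hA : ∀ a ∈ A, ∀ e ∈ A ∪ E, R a e) (hs : ∀ u v, R u v → R v u)
    (hu : u ∈ E) (huA : u ∉ A) : neighbors R (A ∪ E) u = A ∪ neighbors R E u := by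
  ext w
  constructor
  · rintro ⟨h1 | h1, h2⟩
    · exact Or.inl h1
    · exact Or.inr ⟨h1, h2⟩
  · rintro (h | h)
    · exact ⟨Or.inl h, fun hw => huA (hw ▸ h), hs _ _ (hA w h u (Or.inr hu))⟩
    · exact ⟨Or.inr h.1, h.2⟩

theorem union_sdiff_singleton (huA : u ∉ A) : (A ∪ E) \ {u} = A ∪ E \ {u} := by
  rw [Set.union_sdiff_distrib, Set.sdiff_singleton_eq_self huA]

/-- The exchange property survives the addition of cone points. -/
theorem HasExchange.union [DecidableEq V] (hr : ∀ u, R u u)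
    (hs : ∀ u v, R u v → R v u) (hA : ∀ a ∈ A, ∀ e ∈ A ∪ E, R a e)
    (hu : u ∈ E) (huA : u ∉ A) (h : HasExchange R E u) :
    HasExchange R (A ∪ E) u := by
  classical
  refine hasExchange_of_forall hr hs fun F hF => ?_
  rw [neighbors_union hA hs hu huA, isFacet_flag_iff hr hs] at hF
  obtain ⟨⟨h1, h2⟩, h3⟩ := hF
  -- Cone points are related to everything, so discarding them from `F` leaves a facet of the
  -- smaller link.
  obtain ⟨w, hw, huw, hwF⟩ := h (F.filter (· ∈ neighbors R E u)) <| by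
    refine (isFacet_flag_iff hr hs).2 ⟨⟨fun v hv => (Finset.mem_filter.1 hv).2, fun v hv x hx =>
      h2 v (Finset.mem_filter.1 hv).1 x (Finset.mem_filter.1 hx).1⟩, fun t ht hta => ?_⟩
    refine Finset.mem_filter.2 ⟨h3 t (Or.inr ht) fun a ha => ?_, ht⟩
    rcases h1 a ha with haA | haE
    · exact hs _ _ (hA a haA t (Or.inr ht.1))
    · exact hta a (Finset.mem_filter.2 ⟨ha, haE⟩)
  rw [isFacet_flag_iff hr hs] at hwF
  obtain ⟨⟨h4, h5⟩, h6⟩ := hwF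
  refine ⟨w, Or.inr hw, huw, fun a ha => ?_, fun t ht hut hta htw => ?_⟩
  · rcases h1 a ha with haA | haE
    · exact hs _ _ (hA a haA w (Or.inr hw))
    · exact h5 w (Finset.mem_insert_self _ _) a
        (Finset.mem_insert_of_mem (Finset.mem_filter.2 ⟨ha, haE⟩))
  · rcases ht with htA | htE
    · exact absurd (hs _ _ (hA t htA u (Or.inr hu))) hut
    · have htu : t ≠ u := fun h => hut (h ▸ hr u)
      have := h6 t ⟨htE, htu⟩ fun a ha => by
        rcases Finset.mem_insert.1 ha with rfl | ha
        · exact htw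
        · exact hta a (Finset.mem_filter.1 ha).1
      rcases Finset.mem_insert.1 this with h | h
      · exact h
      · exact absurd (Finset.mem_filter.1 h).2.2.2 hut

/-- A vertex with the exchange property is a shedding vertex as soon as its deletion and its link
are pure vertex-decomposable. -/
theorem HasExchange.isSheddingVertex [DecidableEq V] [Finite V] (hr : ∀ u, R u u)
    (hs : ∀ u v, R u v → R v u) (hu : u ∈ E) (h : HasExchange R E u)
    (hdel : (flag R (E \ {u})).IsPureVertexDecomposable)
    (hlink : (flag R (neighbors R E u)).IsPureVertexDecomposable) :
    (flag R E).IsSheddingVertex u := by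
  have hfacet : ∀ F, (flag R (E \ {u})).IsFacet F → (flag R E).IsFacet F := by
    intro F hF
    have hF' := (isFacet_flag_iff hr hs).1 hF
    refine (isFacet_flag_iff hr hs).2 ⟨⟨fun v hv => (hF'.1.1 v hv).1, hF'.1.2⟩, fun t ht hta => ?_⟩
    by_cases htu : t = u
    · subst htu
      exfalso
      -- If the removed vertex were related to all of `F`, then `F` would lie in a facet `G` of the
      -- link; maximality of `F` in the deletion would put the exchange vertex `w` into `F`.
      have hFn : F ∈ (flag R (neighbors R E t)).faces :=
        ⟨fun v hv => ⟨(hF'.1.1 v hv).1, (hF'.1.1 v hv).2, hta v hv⟩, hF'.1.2⟩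
      obtain ⟨G, hG, hFG⟩ := exists_isFacet_ge hFn
      obtain ⟨w, hw, htw, hwG⟩ := h G hG
      have hwF : w ∈ F := by
        rw [← hF.2 _ hwG.1 (hFG.trans (Finset.subset_insert w G))]
        exact Finset.mem_insert_self w G
      exact htw (hta w hwF)
    · exact hF'.2 t ⟨ht, htu⟩ hta
  refine ⟨?_, ⟨fun v hv => ?_, fun v hv w hw => ?_⟩, ?_, ?_, ?_⟩
  · obtain ⟨d, hd⟩ : ∃ d, ∀ F, (flag R (E \ {u})).IsFacet F → F.card = d := by
      by_cases hne : ∃ F, (flag R (E \ {u})).IsFacet F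
      · obtain ⟨F, hF⟩ := hne
        exact ⟨F.card, fun G hG => hdel.isPure G F hG hF⟩
      · exact ⟨0, fun F hF => absurd ⟨F, hF⟩ hne⟩
    have key : ∀ F, (flag R E).IsFacet F → F.card = d := by
      intro F hF
      rw [isFacet_flag_iff hr hs] at hF
      obtain ⟨⟨h1, h2⟩, h3⟩ := hF
      by_cases huF : u ∈ F
      -- Replacing `u` by the exchange vertex turns `F` into a facet of the deletion of the same
      -- size.
      · have hG : (flag R (neighbors R E u)).IsFacet (F.erase u) := by
          refine (isFacet_flag_iff hr hs).2 ⟨⟨fun v hv => ?_, fun v hv w hw => ?_⟩,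
            fun t ht hta => ?_⟩
          · have := Finset.mem_erase.1 hv
            exact ⟨h1 v this.2, this.1, h2 u huF v this.2⟩
          · exact h2 v (Finset.mem_of_mem_erase hv) w (Finset.mem_of_mem_erase hw)
          · refine Finset.mem_erase.2 ⟨ht.2.1, h3 t ht.1 fun a ha => ?_⟩
            by_cases hau : a = u
            · exact hau ▸ hs _ _ ht.2.2
            · exact hta a (Finset.mem_erase.2 ⟨hau, ha⟩)
        obtain ⟨w, hw, huw, hwG⟩ := h _ hG
        have hwn : w ∉ F.erase u := fun h => huw (h2 u huF w (Finset.mem_of_mem_erase h))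
        rw [← hd _ hwG, Finset.card_insert_of_notMem hwn, Finset.card_erase_add_one huF]
      · refine hd F ((isFacet_flag_iff hr hs).2 ⟨⟨fun v hv => ⟨h1 v hv, ?_⟩, h2⟩,
          fun t ht => h3 t ht.1⟩)
        intro hvu
        exact huF (Set.mem_singleton_iff.1 hvu ▸ hv)
    intro F G hF hG
    rw [key F hF, key G hG]
  · rwa [Finset.mem_singleton.1 hv]
  · rw [Finset.mem_singleton.1 hv, Finset.mem_singleton.1 hw]
    exact hr u
  · rwa [deletion_flag]
  · rwa [deletion_flag]
  · rwa [link_flag hr hs hu]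

theorem isSimplex_flag [Finite V] (h : ∀ u ∈ E, ∀ v ∈ E, R u v) : (flag R E).IsSimplex := by
  refine ⟨(Set.toFinite E).toFinset, fun F => ⟨fun hF v hv => ?_, fun hF => ?_⟩⟩
  · exact (Set.Finite.mem_toFinset _).2 (hF.1 v hv)
  · have hE : ∀ v ∈ F, v ∈ E := fun v hv => (Set.Finite.mem_toFinset _).1 (hF hv)
    exact ⟨hE, fun v hv w hw => h v (hE v hv) w (hE w hw)⟩

theorem isConeWithApex_flag (hr : ∀ u, R u u) (hs : ∀ u v, R u v → R v u) (hu : u ∈ E)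
    (h : ∀ v ∈ E, R u v) : (flag R E).IsConeWithApex u := by
  classical
  refine ⟨⟨∅, by simp [mem_flag]⟩, fun F hF => ⟨insert u F, ⟨fun v hv => ?_, fun v hv w hw => ?_⟩,
    Finset.mem_insert_self u F, Finset.subset_insert u F⟩⟩
  · rcases Finset.mem_insert.1 hv with rfl | hv
    · exact hu
    · exact hF.1 v hv
  · rcases Finset.mem_insert.1 hv with rfl | hv' <;> rcases Finset.mem_insert.1 hw with rfl | hw'
    · exact hr _
    · exact h w (hF.1 w hw')
    · exact hs _ _ (h v (hF.1 v hv'))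
    · exact hF.2 v hv' w hw'

end Complex

open Ferrers.Complex

/-! ### Truncated diagrams -/

section Truncation

variable {D : Finset Point}

/-- The compatibility of points, on the vertex set of a diagram. -/
def compatOn (D : Finset Point) (u v : D) : Prop := Compat u v

theorem compatOn_refl (u : D) : compatOn D u u := Compat.refl _

theorem compatOn_symm (u v : D) (h : compatOn D u v) : compatOn D v u := Compat.symm h

theorem exists_of_pt_mem {i j k : ℕ} (h : pt i j k ∈ D) :
    ∃ w : D, px w = i ∧ py w = j ∧ pz w = k := ⟨⟨_, h⟩, rfl, rfl, rfl⟩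

/-- `E` consists of the points of `D` from `u` on that satisfy `z ≤ Z`, in the layer of `u` also
`y ≤ B`, and in the later layers also `y ≤ Y`. -/
def IsWindow (u : D) (B Y Z : ℕ) (E : Set D) : Prop :=
  ∀ v : D, v ∈ E ↔ (u : Point) ≤ v ∧ pz v ≤ Z ∧ (px v = px u → py v ≤ B) ∧ (px u < px v → py v ≤ Y)

/-- The truncations of a diagram that arise from iterated deletions and links. -/
def IsTruncation (E : Set D) : Prop :=
  ∃ (U : Set Point) (i B Y Z : ℕ), IsUpperSet U ∧ (∀ v ∈ U, i ≤ px v) ∧ Y ≤ B ∧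
    ∀ v : D, v ∈ E ↔ (v : Point) ∈ U ∧ pz v ≤ Z ∧ (px v = i → py v ≤ B) ∧ (i < px v → py v ≤ Y)

/-- If `u` lies beyond layer `i`, the bound `B` concerns no point any more and `Y` takes its place
in the layer of `u`. -/
theorem IsTruncation.exists_isWindow {E : Set D} (hE : IsTruncation E) {u : D} (hu : u ∈ E)
    (hmin : ∀ v ∈ E, u ≤ v) : ∃ B Y Z, Y ≤ B ∧ IsWindow u B Y Z E := by
  obtain ⟨U, i, B, Y, Z, hU, hi, hYB, h⟩ := hE
  have hu' := (h u).1 hu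
  rcases (hi u hu'.1).eq_or_lt with hiu | hiu
  · refine ⟨B, Y, Z, hYB, fun v => ⟨fun hv => ⟨hmin v hv, ?_⟩, fun hv => (h v).2 ⟨hU hv.1 hu'.1, ?_⟩⟩⟩
    · rw [← hiu]; exact ((h v).1 hv).2
    · rw [hiu]; exact hv.2
  · refine ⟨Y, Y, Z, le_rfl, fun v => ⟨fun hv => ⟨hmin v hv, ?_⟩,
      fun hv => (h v).2 ⟨hU hv.1 hu'.1, ?_⟩⟩⟩
    · have := (h v).1 hv
      omega
    · have h1 := hv.1
      rw [point_le_iff] at h1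
      omega

theorem IsWindow.mem_iff {u : D} {B Y Z : ℕ} {E : Set D} (hE : IsWindow u B Y Z E) (v : D) :
    v ∈ E ↔ (px u < px v ∨ px u = px v ∧ (py u < py v ∨ py u = py v ∧ pz u ≤ pz v)) ∧
      pz v ≤ Z ∧ (px v = px u → py v ≤ B) ∧ (px u < px v → py v ≤ Y) := by
  rw [hE v, point_le_iff]

theorem IsWindow.isTruncation_sdiff {u : D} {B Y Z : ℕ} {E : Set D} (hE : IsWindow u B Y Z E)
    (hYB : Y ≤ B) : IsTruncation (E \ {u}) := by
  refine ⟨Set.Ioi u, px u, B, Y, Z, isUpperSet_Ioi _, fun v hv => ?_, hYB, fun v => ?_⟩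
  · have := Set.mem_Ioi.1 hv
    rw [point_lt_iff] at this
    omega
  · have h : (u : Point) < v ↔ (u : Point) ≤ v ∧ v ≠ u := by
      rw [lt_iff_le_and_ne, Ne, Ne, Subtype.coe_inj, eq_comm]
    rw [Set.mem_sdiff, hE v, Set.mem_singleton_iff, Set.mem_Ioi, h]
    tauto

/-- Neighbors of `u` in its layer with larger second coordinate satisfy `z ≤ pz u`; those in later
layers satisfy also `y ≤ py u`. These are the new bounds. -/
theorem IsWindow.isTruncation_neighbors {u : D} {B Y Z : ℕ} {E : Set D}
    (hE : IsWindow u B Y Z E) (hu : u ∈ E) (hYB : Y ≤ B) :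
    IsTruncation {w ∈ neighbors (compatOn D) E u | px u < px w ∨ py u < py w} := by
  refine ⟨{v | px u < px v ∨ px u = px v ∧ py u < py v}, px u, B, min Y (py u), pz u,
    fun v w hvw hv => ?_, fun v hv => ?_, (min_le_left _ _).trans hYB, fun v => ?_⟩
  · rw [point_le_iff] at hvw
    simp only [Set.mem_ofPred_eq] at hv ⊢
    omega
  · simp only [Set.mem_ofPred_eq] at hv
    omega
  · have hu' := (hE.mem_iff u).1 hu
    have hne : px u < px v ∨ py u < py v → v ≠ u := by
      rintro h rfl
      omega
    simp only [neighbors, compatOn, Compat, Set.mem_ofPred_eq, hE.mem_iff]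
    constructor
    · rintro ⟨⟨h1, -, h2⟩, h3⟩
      omega
    · intro h
      have h3 : px u < px v ∨ py u < py v := by omega
      exact ⟨⟨by omega, hne h3, by omega⟩, h3⟩

/-- The first vertex of a truncation has the exchange property when the point that follows it
diagonally in its layer belongs to the truncation. -/
theorem IsWindow.exchange_diagonal {u : D} {B Y Z : ℕ} {E : Set D} (hE : IsWindow u B Y Z E)
    (hD : IsFerrers D) {F : Finset D}
    (hF : (flag (compatOn D) (neighbors (compatOn D) E u)).IsFacet F) {w : D} (hw : w ∈ E)
    (hwx : px w = px u) (hwy : py w = py u + 1) (hwz : pz w = pz u + 1) :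
    (∀ a ∈ F, compatOn D w a) ∧
      ∀ t ∈ E, ¬ compatOn D u t → (∀ a ∈ F, compatOn D t a) → compatOn D t w → t = w := by
  obtain ⟨⟨h1, -⟩, h3⟩ := (isFacet_flag_iff compatOn_refl compatOn_symm).1 hF
  simp only [neighbors, compatOn, Compat, Set.mem_ofPred_eq, hE.mem_iff] at *
  obtain ⟨hux, huy, huz⟩ := hD.pos u u.2
  -- The two corners between `u` and `w` are compatible with all neighbors of `u`, so they lie in
  -- `F`, and together they leave `w` as the only candidate incompatible with `u`.
  obtain ⟨p, hpx, hpy, hpz⟩ := exists_of_pt_mem (hD.pt_mem w.2 hux hwx.ge huy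
    (by omega : py u ≤ py w) (by omega : 1 ≤ pz w) le_rfl)
  obtain ⟨q, hqx, hqy, hqz⟩ := exists_of_pt_mem (hD.pt_mem w.2 hux hwx.ge
    (by omega : 1 ≤ py w) le_rfl huz (by omega : pz u ≤ pz w))
  have hpF : p ∈ F := by
    refine h3 p ⟨by omega, ?_, by omega⟩ fun a ha => ?_
    · rintro rfl
      omega
    · have := h1 a ha
      omega
  have hqF : q ∈ F := by
    refine h3 q ⟨by omega, ?_, by omega⟩ fun a ha => ?_
    · rintro rfl
      omega
    · have := h1 a ha
      omega
  refine ⟨fun a ha => ?_, fun t ht hut hta htw => ?_⟩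
  · have ha' := h1 a ha
    have hne : ¬ (px a = px u ∧ py a = py u ∧ pz a = pz u) := fun h =>
      ha'.2.1 (Subtype.ext (point_ext h.1 h.2.1 h.2.2))
    omega
  · have h4 := hta p hpF
    have h5 := hta q hqF
    exact Subtype.ext (point_ext (by omega) (by omega) (by omega))

end Truncation

/-! ### Exchange vertices in the next layer -/

section Exchange

variable {D : Finset Point}

/-- The largest value of `f` on the elements of `F` with `P`, or `1` if there are none. -/
theorem exists_max_or_one {V : Type*} (F : Finset V) (P : V → Prop) (f : V → ℕ) :
    ∃ k, (k = 1 ∨ ∃ s ∈ F, P s ∧ f s = k) ∧ ∀ s ∈ F, P s → f s ≤ k := by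
  classical
  by_cases hne : (F.filter P).Nonempty
  · obtain ⟨s, hs, hmax⟩ := (F.filter P).exists_max_image f hne
    obtain ⟨hsF, hsP⟩ := Finset.mem_filter.1 hs
    exact ⟨f s, Or.inr ⟨s, hsF, hsP, rfl⟩, fun t ht htP =>
      hmax t (Finset.mem_filter.2 ⟨ht, htP⟩)⟩
  · exact ⟨1, Or.inl rfl, fun t ht htP => absurd ⟨t, Finset.mem_filter.2 ⟨ht, htP⟩⟩ hne⟩

/-- The exchange property when a later layer reaches farther than `u` in the second coordinate. -/
theorem IsWindow.exchange_y {u : D} {B Y Z : ℕ} {E : Set D} (hE : IsWindow u B Y Z E)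
    (hD : IsFerrers D) (hS : StrongProjectionProperty D) (hu : u ∈ E) (hYB : Y ≤ B) {F : Finset D}
    (hF : (flag (compatOn D) (neighbors (compatOn D) E u)).IsFacet F)
    (hdiag : ∀ w ∈ E, ¬ (px w = px u ∧ py w = py u + 1 ∧ pz w = pz u + 1))
    {v : D} (hv : v ∈ E) (hvx : px u < px v) (hvy : py u < py v) :
    ∃ w ∈ E, ¬ compatOn D u w ∧ (∀ a ∈ F, compatOn D w a) ∧
      ∀ t ∈ E, ¬ compatOn D u t → (∀ a ∈ F, compatOn D t a) → compatOn D t w → t = w := by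
  obtain ⟨⟨h1, h2⟩, h3⟩ := (isFacet_flag_iff compatOn_refl compatOn_symm).1 hF
  simp only [neighbors, compatOn, Compat, Set.mem_ofPred_eq, hE.mem_iff] at *
  obtain ⟨hux, huy, huz⟩ := hD.pos u u.2
  obtain ⟨hvx1, hvy1, hvz1⟩ := hD.pos v v.2
  -- A point of this layer above height `pz u` has a row reaching `py v`, which would produce the
  -- excluded diagonal point.
  have hflat : ∀ t : D, ((px u < px t ∨ px u = px t ∧ (py u < py t ∨ py u = py t ∧ pz u ≤ pz t)) ∧
      pz t ≤ Z ∧ (px t = px u → py t ≤ B) ∧ (px u < px t → py t ≤ Y)) → px t = px u →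
      pz t ≤ pz u := by
    intro t ht htx
    by_contra htz
    obtain ⟨w, hwx, hwy, hwz⟩ := exists_of_pt_mem (hD.pt_mem
      (hS.pt_mem_y hD t.2 v.2 (by omega)) (i := px u) (j := py u + 1) (k := pz u + 1) hux
      (by rw [px_pt]; omega) (by omega) (by rw [py_pt]; omega) (by omega) (by rw [pz_pt]; omega))
    exact hdiag w (by omega) ⟨hwx, hwy, hwz⟩
  -- The exchange vertex is `(px u + 1, py u + 1, k)`: `k` is the least height allowed by the points
  -- of `F` two or more layers after `u`.
  obtain ⟨k, hk, hkmax⟩ := exists_max_or_one F (fun s : D => px u + 2 ≤ px s) (fun s : D => pz s)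
  have hk1 : 1 ≤ k := by
    rcases hk with rfl | ⟨s, -, -, rfl⟩
    · exact le_rfl
    · exact (hD.pos s s.2).2.2
  have hku : k ≤ pz u := by
    rcases hk with rfl | ⟨s, hs, hsx, rfl⟩
    · exact huz
    · have := h1 s hs
      omega
  have hwD : pt (px u + 1) (py u + 1) k ∈ D := by
    have h0 : pt (px u + 1) (py u + 1) 1 ∈ D :=
      hD.pt_mem v.2 (by omega) hvx (by omega) hvy le_rfl hvz1
    rcases hk with rfl | ⟨s, -, hsx, rfl⟩
    · exact h0
    · exact hS.pt_mem_z hD h0 s.2 (by rw [px_pt]; omega)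
  have hFk : ∀ a ∈ F, px a ≤ px u + 1 → k ≤ pz a := by
    intro a ha hax
    rcases hk with rfl | ⟨s, hs, hsx, rfl⟩
    · exact (hD.pos a a.2).2.2
    · have := h2 a ha s hs
      omega
  -- As in the diagonal case, `p` and `q` belong to `F` and pin down `w`: `q` bounds the second
  -- coordinate by `py u + 1`, while `p` excludes layers beyond `px u + 1` and heights above `k`.
  obtain ⟨p, hpx, hpy, hpz⟩ := exists_of_pt_mem (hD.pt_mem hwD (i := px u + 1) (j := py u)
    (k := k) (by omega) le_rfl huy (by rw [py_pt]; omega) hk1 le_rfl)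
  obtain ⟨q, hqx, hqy, hqz⟩ := exists_of_pt_mem (hD.pt_mem (hS.pt_mem_y hD u.2 v.2 hvx)
    (i := px u) (j := py u + 1) (k := pz u) hux le_rfl (by omega) hvy huz le_rfl)
  obtain ⟨w, hwx, hwy, hwz⟩ := exists_of_pt_mem hwD
  have hpF : p ∈ F := by
    refine h3 p ⟨by omega, ?_, by omega⟩ fun a ha => ?_
    · rintro rfl
      omega
    · have := h1 a ha
      have := hFk a ha
      have := hkmax a ha
      omega
  have hFy : ∀ a ∈ F, px a = px u → py u < py a := by
    intro a ha hax
    have ha' := h1 a ha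
    have := hflat a ha'.1 hax
    have hne : ¬ (px a = px u ∧ py a = py u ∧ pz a = pz u) := fun h =>
      ha'.2.1 (Subtype.ext (point_ext h.1 h.2.1 h.2.2))
    omega
  have hqF : q ∈ F := by
    refine h3 q ⟨by omega, ?_, by omega⟩ fun a ha => ?_
    · rintro rfl
      omega
    · have := h1 a ha
      have := hFy a ha
      omega
  refine ⟨w, by omega, by omega, fun a ha => ?_, fun t ht hut hta htw => ?_⟩
  · have := h1 a ha
    have := hFk a ha
    have := hkmax a ha
    have := hFy a ha
    omega
  · have h4 := hta p hpF
    have h5 := hta q hqF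
    have h6 := hflat t ht
    have h7 : px t ≤ px u + 1 → k ≤ pz t := by
      rcases hk with rfl | ⟨s, hs, hsx, rfl⟩
      · exact fun _ => (hD.pos t t.2).2.2
      · have := hta s hs
        omega
    exact Subtype.ext (point_ext (by omega) (by omega) (by omega))

/-- The exchange property when a later layer reaches farther than `u` in the third coordinate. -/
theorem IsWindow.exchange_z {u : D} {B Y Z : ℕ} {E : Set D} (hE : IsWindow u B Y Z E)
    (hD : IsFerrers D) (hS : StrongProjectionProperty D) (hu : u ∈ E) (hYB : Y ≤ B) {F : Finset D}
    (hF : (flag (compatOn D) (neighbors (compatOn D) E u)).IsFacet F)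
    (hdiag : ∀ w ∈ E, ¬ (px w = px u ∧ py w = py u + 1 ∧ pz w = pz u + 1))
    {v : D} (hv : v ∈ E) (hvx : px u < px v) (hvz : pz u < pz v) :
    ∃ w ∈ E, ¬ compatOn D u w ∧ (∀ a ∈ F, compatOn D w a) ∧
      ∀ t ∈ E, ¬ compatOn D u t → (∀ a ∈ F, compatOn D t a) → compatOn D t w → t = w := by
  obtain ⟨⟨h1, h2⟩, h3⟩ := (isFacet_flag_iff compatOn_refl compatOn_symm).1 hF
  have huB : py u ≤ B := ((hE.mem_iff u).1 hu).2.2.1 rfl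
  simp only [neighbors, compatOn, Compat, Set.mem_ofPred_eq, hE.mem_iff] at *
  obtain ⟨hux, huy, huz⟩ := hD.pos u u.2
  obtain ⟨hvx1, hvy1, hvz1⟩ := hD.pos v v.2
  have hflat : ∀ t : D, ((px u < px t ∨ px u = px t ∧ (py u < py t ∨ py u = py t ∧ pz u ≤ pz t)) ∧
      pz t ≤ Z ∧ (px t = px u → py t ≤ B) ∧ (px u < px t → py t ≤ Y)) → px t = px u →
      py t ≤ py u := by
    intro t ht htx
    by_contra hty
    obtain ⟨w, hwx, hwy, hwz⟩ := exists_of_pt_mem (hD.pt_mem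
      (hS.pt_mem_z hD t.2 v.2 (by omega)) (i := px u) (j := py u + 1) (k := pz u + 1) hux
      (by rw [px_pt]; omega) (by omega) (by rw [py_pt]; omega) (by omega) (by rw [pz_pt]; omega))
    exact hdiag w (by omega) ⟨hwx, hwy, hwz⟩
  obtain ⟨j, hj, hjmax⟩ := exists_max_or_one F (fun s : D => px u + 2 ≤ px s) (fun s : D => py s)
  have hj1 : 1 ≤ j := by
    rcases hj with rfl | ⟨s, -, -, rfl⟩
    · exact le_rfl
    · exact (hD.pos s s.2).2.1
  -- Here `w` takes its second coordinate from `F`, so the bound `Y` must be checked separately; for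
  -- the default value `1` it comes from `v`.
  have hju : j ≤ py u ∧ j ≤ Y := by
    rcases hj with rfl | ⟨s, hs, hsx, rfl⟩
    · exact ⟨huy, by omega⟩
    · have := h1 s hs
      omega
  have hwD : pt (px u + 1) j (pz u + 1) ∈ D := by
    have h0 : pt (px u + 1) 1 (pz u + 1) ∈ D :=
      hD.pt_mem v.2 (by omega) hvx le_rfl hvy1 (by omega) hvz
    rcases hj with rfl | ⟨s, -, hsx, rfl⟩
    · exact h0
    · exact hS.pt_mem_y hD h0 s.2 (by rw [px_pt]; omega)
  have hFj : ∀ a ∈ F, px a ≤ px u + 1 → j ≤ py a := by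
    intro a ha hax
    rcases hj with rfl | ⟨s, hs, hsx, rfl⟩
    · exact (hD.pos a a.2).2.1
    · have := h2 a ha s hs
      omega
  obtain ⟨p, hpx, hpy, hpz⟩ := exists_of_pt_mem (hD.pt_mem hwD (i := px u + 1) (j := j)
    (k := pz u) (by omega) le_rfl hj1 le_rfl huz (by rw [pz_pt]; omega))
  obtain ⟨q, hqx, hqy, hqz⟩ := exists_of_pt_mem (hD.pt_mem (hS.pt_mem_z hD u.2 v.2 hvx)
    (i := px u) (j := py u) (k := pz u + 1) hux le_rfl huy le_rfl (by omega) hvz)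
  obtain ⟨w, hwx, hwy, hwz⟩ := exists_of_pt_mem hwD
  have hFz : ∀ a ∈ F, px a = px u → py a = py u ∧ pz u < pz a := by
    intro a ha hax
    have ha' := h1 a ha
    have := hflat a ha'.1 hax
    have hne : ¬ (px a = px u ∧ py a = py u ∧ pz a = pz u) := fun h =>
      ha'.2.1 (Subtype.ext (point_ext h.1 h.2.1 h.2.2))
    omega
  have hpF : p ∈ F := by
    refine h3 p ⟨by omega, ?_, by omega⟩ fun a ha => ?_
    · rintro rfl
      omega
    · have := h1 a ha
      have := hFj a ha
      have := hjmax a ha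
      have := hFz a ha
      omega
  have hqF : q ∈ F := by
    refine h3 q ⟨by omega, ?_, by omega⟩ fun a ha => ?_
    · rintro rfl
      omega
    · have := h1 a ha
      have := hFz a ha
      omega
  refine ⟨w, by omega, by omega, fun a ha => ?_, fun t ht hut hta htw => ?_⟩
  · have := h1 a ha
    have := hFj a ha
    have := hjmax a ha
    have := hFz a ha
    omega
  · have h4 := hta p hpF
    have h5 := hta q hqF
    have h6 := hflat t ht
    have h7 : px t ≤ px u + 1 → j ≤ py t := by
      rcases hj with rfl | ⟨s, hs, hsx, rfl⟩
      · exact fun _ => (hD.pos t t.2).2.1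
      · have := hta s hs
        omega
    exact Subtype.ext (point_ext (by omega) (by omega) (by omega))

/-- A vertex incompatible with `u` in its own layer forces the diagonal point to be present; without
that point, the incompatible vertex lies in a later layer. -/
theorem IsWindow.hasExchange {u : D} {B Y Z : ℕ} {E : Set D} (hE : IsWindow u B Y Z E)
    (hD : IsFerrers D) (hS : StrongProjectionProperty D) (hu : u ∈ E) (hYB : Y ≤ B)
    (hapex : ¬ ∀ v ∈ E, compatOn D u v) : HasExchange (compatOn D) E u := by
  refine hasExchange_of_forall compatOn_refl compatOn_symm fun F hF => ?_
  by_cases hdiag : ∀ w ∈ E, ¬ (px w = px u ∧ py w = py u + 1 ∧ pz w = pz u + 1)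
  · push Not at hapex
    obtain ⟨v, hv, hc⟩ := hapex
    have hv' := (hE.mem_iff v).1 hv
    unfold compatOn Compat at hc
    rcases hv'.1 with hx | hx
    · by_cases hy : py u < py v
      · exact hE.exchange_y hD hS hu hYB hF hdiag hv hx hy
      · exact hE.exchange_z hD hS hu hYB hF hdiag hv hx (by omega)
    · obtain ⟨hux, huy, huz⟩ := hD.pos u u.2
      obtain ⟨w, hwx, hwy, hwz⟩ := exists_of_pt_mem (hD.pt_mem v.2 (i := px u) (j := py u + 1)
        (k := pz u + 1) hux (by omega) (by omega) (by omega) (by omega) (by omega))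
      exact absurd ⟨hwx, hwy, hwz⟩ (hdiag w ((hE.mem_iff w).2 (by omega)))
  · push Not at hdiag
    obtain ⟨w, hw, hwx, hwy, hwz⟩ := hdiag
    exact ⟨w, hw, by unfold compatOn Compat; omega, hE.exchange_diagonal hD hF hw hwx hwy hwz⟩

end Exchange

/-! ### Vertex decomposability -/

section Decomposition

variable {D : Finset Point}

/-- The neighbors of the first vertex of a truncation form a truncation with cone points added. -/
theorem IsWindow.neighbors_eq_union {u : D} {B Y Z : ℕ} {E : Set D} (hE : IsWindow u B Y Z E)
    (hu : u ∈ E) (hYB : Y ≤ B) :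
    ∃ A' E' : Set D, neighbors (compatOn D) E u = A' ∪ E' ∧ IsTruncation E' ∧
      ∀ a ∈ A', ∀ e ∈ A' ∪ E', compatOn D a e := by
  set N := neighbors (compatOn D) E u
  have hN : N = {w ∈ N | ¬ (px u < px w ∨ py u < py w)} ∪ {w ∈ N | px u < px w ∨ py u < py w} := by
    ext w
    simp only [Set.mem_union, Set.mem_ofPred_eq]
    tauto
  refine ⟨_, _, hN, hE.isTruncation_neighbors hu hYB, ?_⟩
  rw [← hN]
  rintro a ⟨⟨ha1, hau, ha2⟩, hax⟩ e ⟨he1, heu, he2⟩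
  have hne : ∀ w : D, w ≠ u → ¬ (px w = px u ∧ py w = py u ∧ pz w = pz u) := fun w hw h =>
    hw (Subtype.ext (point_ext h.1 h.2.1 h.2.2))
  have := hne a hau
  have := hne e heu
  rw [hE.mem_iff] at ha1 he1
  unfold compatOn Compat at ha2 he2 ⊢
  omega

/-- The cone points `A` are carried along because apexes and links create them; the induction counts
only `E`. -/
theorem isPureVertexDecomposable_union (hD : IsFerrers D) (hS : StrongProjectionProperty D)
    {E A : Set D} (hE : IsTruncation E) (hA : ∀ a ∈ A, ∀ e ∈ A ∪ E, compatOn D a e) :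
    (flag (compatOn D) (A ∪ E)).IsPureVertexDecomposable := by
  induction hn : E.ncard using Nat.strong_induction_on generalizing E A with
  | _ n ih =>
  subst hn
  rcases E.eq_empty_or_nonempty with rfl | hne
  · rw [Set.union_empty] at hA ⊢
    exact .simplex _ (isSimplex_flag hA)
  obtain ⟨u, hu, hmin⟩ := E.exists_min_image id (Set.toFinite E) hne
  obtain ⟨B, Y, Z, hYB, hW⟩ := hE.exists_isWindow hu hmin
  have hcard : (E \ {u}).ncard < E.ncard := Set.ncard_sdiff_singleton_lt_of_mem hu
  by_cases hapex : ∀ v ∈ E, compatOn D u v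
  -- An apex is not shed but moved into the set of cone points.
  · have h : A ∪ E = insert u A ∪ E \ {u} := by
      rw [Set.insert_union, ← Set.union_insert, Set.insert_sdiff_singleton, Set.insert_eq_of_mem hu]
    rw [h]
    refine ih _ hcard (hW.isTruncation_sdiff hYB) ?_ rfl
    rw [← h]
    rintro a (rfl | ha) e (he | he)
    · exact compatOn_symm _ _ (hA e he a (Or.inr hu))
    · exact hapex e he
    · exact hA a ha e (Or.inl he)
    · exact hA a ha e (Or.inr he)
  · have huA : u ∉ A := fun h => hapex fun v hv => hA u h v (Or.inr hv)
    have hEx := (hW.hasExchange hD hS hu hYB hapex).union compatOn_refl compatOn_symm hA hu huA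
    refine (hEx.isSheddingVertex compatOn_refl compatOn_symm (Or.inr hu) ?_ ?_
      ).isPureVertexDecomposable
    · rw [union_sdiff_singleton huA]
      exact ih _ hcard (hW.isTruncation_sdiff hYB)
        (fun a ha e he => hA a ha e (he.imp_right fun h => h.1)) rfl
    · rw [neighbors_union hA compatOn_symm hu huA]
      obtain ⟨A', E', hN, hE', hA'⟩ := hW.neighbors_eq_union hu hYB
      have hsub : ∀ w ∈ A' ∪ E', w ∈ E ∧ w ≠ u := fun w hw => by
        rw [← hN] at hw
        exact ⟨hw.1, hw.2.1⟩
      rw [hN, ← Set.union_assoc]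
      refine ih _ ?_ hE' ?_ rfl
      · exact Set.ncard_lt_ncard ⟨fun w hw => (hsub w (Or.inr hw)).1,
          fun h => (hsub u (Or.inr (h hu))).2 rfl⟩ (Set.toFinite E)
      · rw [Set.union_assoc]
        rintro a (ha | ha) e (he | he)
        · exact hA a ha e (Or.inl he)
        · exact hA a ha e (Or.inr (hsub e he).1)
        · exact compatOn_symm _ _ (hA e he a (Or.inr (hsub a (Or.inl ha)).1))
        · exact hA' a ha e he

/-- Bounds taken as suprema over `D` cut nothing off. -/
theorem isTruncation_univ : IsTruncation (Set.univ : Set D) :=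
  ⟨Set.univ, 0, D.sup py, D.sup py, D.sup pz, isUpperSet_univ, fun _ _ => Nat.zero_le _, le_rfl,
    fun v => ⟨fun _ => ⟨trivial, Finset.le_sup v.2, fun _ => Finset.le_sup v.2, fun _ =>
      Finset.le_sup v.2⟩, fun _ => trivial⟩⟩

theorem isTruncation_Ici (u : D) : IsTruncation {w | u ≤ w} := by
  refine ⟨Set.Ici u, 0, D.sup py, D.sup py, D.sup pz, isUpperSet_Ici _, fun _ _ => Nat.zero_le _,
    le_rfl, fun v => ⟨fun h => ⟨h, Finset.le_sup v.2, fun _ => Finset.le_sup v.2, fun _ =>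
      Finset.le_sup v.2⟩, fun h => h.1⟩⟩

end Decomposition

end Ferrers

open Ferrers Ferrers.Complex in
theorem lemma5p1 (K : Type*) [Field K] (D : Finset Ferrers.Point) (hD : Ferrers.IsFerrers D)
    (hS : Ferrers.StrongProjectionProperty D) :
    Ferrers.IsSquarefreeMonomialIdeal (Ferrers.initialMinorsIdeal K D) ∧
    (Ferrers.diagramComplex K D).IsPureVertexDecomposable ∧
    (Ferrers.diagramComplex K D).IsSheddingOrder := by
  have hΔ : diagramComplex K D = flag (compatOn D) Set.univ := ext_faces fun F => by
    rw [mem_faces_diagramComplex hD hS, mem_flag]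
    exact ⟨fun h => ⟨fun _ _ => trivial, h⟩, fun h => h.2⟩
  have hvd : ∀ E : Set D, IsTruncation E →
      (flag (compatOn D) E).IsPureVertexDecomposable := fun E hE => by
    have := isPureVertexDecomposable_union hD hS (A := ∅) hE (by simp)
    rwa [Set.empty_union] at this
  refine ⟨⟨_, initialMinorsIdeal_eq hD hS⟩, ?_, fun u => ?_⟩
  · rw [hΔ]
    exact hvd _ isTruncation_univ
  · rw [hΔ, restrict_flag, Set.univ_inter]
    have hu : u ∈ {w | u ≤ w} := le_refl u
    obtain ⟨B, Y, Z, hYB, hW⟩ := (isTruncation_Ici u).exists_isWindow hu fun _ h => h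
    refine ⟨hvd _ (isTruncation_Ici u), ?_⟩
    by_cases hapex : ∀ v ∈ {w | u ≤ w}, compatOn D u v
    · exact Or.inl (isConeWithApex_flag compatOn_refl compatOn_symm hu hapex)
    · refine Or.inr ((hW.hasExchange hD hS hu hYB hapex).isSheddingVertex compatOn_refl
        compatOn_symm hu (hvd _ (hW.isTruncation_sdiff hYB)) ?_)
      obtain ⟨A', E', hN, hE', hA'⟩ := hW.neighbors_eq_union hu hYB
      rw [hN]
      exact isPureVertexDecomposable_union hD hS hE' hA'
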